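/- For $d \ge 0$ let $\mathcal{H}(2,d)$ denote the set of polynomials $p(x,y)$ with real coefficients, of total degree exactly $d$, such that all coefficients of $p$ are nonnegative and $p(x,y)=1$ whenever $x,y\in\mathbb{R}$ and $x+y=1$. Let $N(p)$ be the number of monomials that occur in $p$ with nonzero coefficient, and call $f\in\mathcal{H}(2,d)$ sharp if $N(f)\le N(g)$ for every $g\in\mathcal{H}(2,d)$. Let $d>1$ be an odd integer and let $f\in\mathcal{H}(2,d)$ be sharp. Then at least one monomial of degree $d-1$ has a nonzero coefficient in $f$. -/

import Mathlib

/-- `H(2,d)`: the real polynomials `p(x,y)` of degree exactly `d`, with nonnegative coefficients,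
such that `p(x,y) = 1` whenever `x + y = 1`. -/
def H2 (d : ℕ) : Set (MvPolynomial (Fin 2) ℝ) :=
  {p | p.totalDegree = d ∧ (∀ m, 0 ≤ p.coeff m) ∧
    ∀ x y : ℝ, x + y = 1 → MvPolynomial.eval ![x, y] p = 1}

/-- `N(p)`: the number of distinct monomials of `p` (those with nonzero coefficient). -/
def numTerms (p : MvPolynomial (Fin 2) ℝ) : ℕ := p.support.card

/-- `p` is sharp in degree `d`: it lies in `H(2,d)` and its number of terms is minimal there. -/
def IsSharp (d : ℕ) (p : MvPolynomial (Fin 2) ℝ) : Prop :=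
  p ∈ H2 d ∧ ∀ g ∈ H2 d, numTerms p ≤ numTerms g

/-! Write `f - 1 = (x + y - 1) q`. Setting `y = -1`, the homogeneous components satisfy `Q_r = (X -
1) Q_{r-1} - P_r`. By Descartes, multiplication by `X - 1` adds at least one sign variation, while
subtracting `P_r` removes at most two per term of `P_r`. Nonnegative coefficients keep `Q_r ≠ 0` for
`r < d`, and `Q_d = 0` makes `P_d = (X - 1) Q_{d-1}` rich in terms; this balance is
`le_two_mul_sum_card_support`. If `P_{d-1} = 0`, then `Q_{d-1}` also has a factor `X - 1`, which
improves the bound to `d + 4 ≤ 2 N(f)`. For odd `d`, the Lucas polynomial plus `y ^ d` has at most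
`(d + 3) / 2` terms, so `f` is not sharp. -/

namespace Polynomial

variable {R : Type*} [Semiring R]

/-! ### Sign variations under changes of coefficients -/

theorem erase_eq_self_of_coeff_eq_zero {f : R[X]} {i : ℕ} (h : f.coeff i = 0) :
    f.erase i = f := by
  ext k
  rw [coeff_erase]
  split_ifs with hk
  · rw [hk, h]
  · rfl

theorem erase_eraseLead_comm (f : R[X]) {i : ℕ} (hi : i ≠ f.natDegree) :
    (f.erase i).natDegree = f.natDegree ∧ (f.erase i).leadingCoeff = f.leadingCoeff ∧
      (f.erase i).eraseLead = f.eraseLead.erase i := by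
  have hdeg : (f.erase i).natDegree = f.natDegree := by
    by_cases h0 : f = 0
    · simp [h0]
    apply le_antisymm
    · refine natDegree_le_iff_coeff_eq_zero.2 fun k hk => ?_
      rw [coeff_erase]
      split_ifs
      · rfl
      · exact coeff_eq_zero_of_natDegree_lt hk
    · apply le_natDegree_of_ne_zero
      rw [coeff_erase, if_neg hi.symm]
      simpa using h0
  refine ⟨hdeg, ?_, ?_⟩
  · rw [leadingCoeff, hdeg, coeff_erase, if_neg hi.symm, leadingCoeff]
  · ext k
    rw [eraseLead_coeff, hdeg, coeff_erase, coeff_erase, eraseLead_coeff]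
    split_ifs <;> rfl

section signVariations

variable [LinearOrder R]

/-- Erasing a coefficient does not increase the number of sign variations, and lowers it by at
most two. -/
theorem signVariations_erase_bounds (i : ℕ) (f : R[X]) :
    (f.erase i).signVariations ≤ f.signVariations ∧
      f.signVariations ≤ (f.erase i).signVariations + 2 := by
  induction hn : f.support.card using Nat.strong_induction_on generalizing f with
  | _ n ih =>
    by_cases hci : f.coeff i = 0
    · rw [erase_eq_self_of_coeff_eq_zero hci]; omega
    have h0 : f ≠ 0 := by rintro rfl; simp at hci
    by_cases hi : i = f.natDegree
    · have he : f.erase i = f.eraseLead := by rw [hi]; rfl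
      rw [he]
      have := signVariations_eraseLead_le f
      have := signVariations_le_eraseLead_succ f
      omega
    obtain ⟨hd, hl, hel⟩ := erase_eraseLead_comm f hi
    have hg0 : f.erase i ≠ 0 := by
      intro h
      rw [h] at hl
      exact h0 (leadingCoeff_eq_zero.1 (by simpa using hl.symm))
    have hci' : f.eraseLead.coeff i ≠ 0 := by rwa [eraseLead_coeff_of_ne i hi]
    have he0 : f.eraseLead ≠ 0 := by intro h; simp [h] at hci'
    have e1 := signVariations_eq_eraseLead_add_ite h0
    have e2 := signVariations_eq_eraseLead_add_ite hg0
    rw [hl, hel] at e2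
    by_cases hi2 : i = f.eraseLead.natDegree
    · have he : f.eraseLead.erase i = f.eraseLead.eraseLead := by rw [hi2]; rfl
      rw [he] at e2
      have e3 := signVariations_eq_eraseLead_add_ite he0
      have hs1 : SignType.sign f.leadingCoeff ≠ 0 := by simpa using h0
      have hs2 : SignType.sign f.eraseLead.leadingCoeff ≠ 0 := by simpa using he0
      revert e1 e2 e3 hs1 hs2
      generalize SignType.sign f.leadingCoeff = a
      generalize SignType.sign f.eraseLead.leadingCoeff = b
      generalize SignType.sign f.eraseLead.eraseLead.leadingCoeff = c
      intro e1 e2 e3 hs1 hs2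
      rw [e1, e2, e3]
      -- Deleting a nonzero sign `b` between `a` and `c` creates no variation: if `a = -c`, then `b`
      -- is opposite to one of them.
      have key : (if a = -c then 1 else 0) ≤
          ((if b = -c then 1 else 0) + if a = -b then 1 else 0 : ℕ) := by
        clear e1 e2 e3
        revert a b c
        decide
      constructor
      · omega
      · split_ifs <;> omega
    · obtain ⟨-, hl2, -⟩ := erase_eraseLead_comm f.eraseLead hi2
      rw [hl2] at e2
      have := ih _ (hn ▸ eraseLead_support_card_lt h0) f.eraseLead rfl
      omega

end signVariations

theorem signVariations_add_one_le_card_support [LinearOrder R] {f : R[X]} (hf : f ≠ 0) :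
    f.signVariations + 1 ≤ f.support.card := by
  induction hn : f.support.card using Nat.strong_induction_on generalizing f with
  | _ n ih =>
    by_cases he : f.eraseLead = 0
    · have hm : f = monomial f.natDegree f.leadingCoeff := by
        conv_lhs => rw [← eraseLead_add_monomial_natDegree_leadingCoeff f, he, zero_add]
      have hs : f.signVariations = 0 := by rw [hm, signVariations_monomial]
      have : f.support.card ≠ 0 := by simpa using hf
      omega
    · have hlt := eraseLead_support_card_lt hf
      have := ih _ (hn ▸ hlt) he rfl
      have := signVariations_le_eraseLead_succ f
      omega

/-- Both polynomials become equal once the coefficient of index `i` is erased. -/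
theorem signVariations_le_sub_monomial {R : Type*} [Ring R] [LinearOrder R]
    (f : R[X]) (i : ℕ) (c : R) :
    f.signVariations ≤ (f - monomial i c).signVariations + 2 := by
  have h : (f - monomial i c).erase i = f.erase i := by
    ext k
    simp only [coeff_erase, coeff_sub, coeff_monomial]
    split_ifs with h1 h2
    · rfl
    · exact absurd h2.symm h1
    · simp
  have h1 := (signVariations_erase_bounds i f).2
  have h2 := (signVariations_erase_bounds i (f - monomial i c)).1
  rw [h] at h2
  omega

theorem signVariations_le_sub_add_card_support {R : Type*} [Ring R] [LinearOrder R]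
    (f g : R[X]) :
    f.signVariations ≤ (f - g).signVariations + 2 * g.support.card := by
  induction hn : g.support.card using Nat.strong_induction_on generalizing f g with
  | _ n ih =>
    by_cases hg : g = 0
    · subst hg; simp
    have hlt := eraseLead_support_card_lt hg
    have h1 := ih _ (hn ▸ hlt) (f - monomial g.natDegree g.leadingCoeff) g.eraseLead rfl
    have h2 : f - monomial g.natDegree g.leadingCoeff - g.eraseLead = f - g := by
      conv_rhs => rw [← eraseLead_add_monomial_natDegree_leadingCoeff g]
      abel
    rw [h2] at h1
    have h3 := signVariations_le_sub_monomial f g.natDegree g.leadingCoeff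
    omega

/-! ### The quotient recursion and the count of terms -/

/-- The homogeneous components, in dehomogenized form, of the quotient of a bivariate polynomial
minus one by a linear form minus one, computed from the components `P j` of that polynomial. -/
noncomputable def quotientComponent (P : ℕ → ℝ[X]) : ℕ → ℝ[X]
  | 0 => 1 - P 0
  | r + 1 => (X - 1) * quotientComponent P r - P (r + 1)

theorem eval_quotientComponent (P : ℕ → ℝ[X]) (r : ℕ) {t : ℝ} (ht : t ≠ 1) :
    (quotientComponent P r).eval t =
      (t - 1) ^ r * (1 - ∑ j ∈ Finset.range (r + 1), (P j).eval t / (t - 1) ^ j) := by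
  have hs : t - 1 ≠ 0 := sub_ne_zero.2 ht
  induction r with
  | zero => simp [quotientComponent]
  | succ r ih =>
    rw [Finset.sum_range_succ, quotientComponent]
    simp only [eval_sub, eval_mul, eval_X, eval_one, ih]
    field_simp
    ring

theorem succ_signVariations_le_X_sub_one_mul {f : ℝ[X]} (hf : f ≠ 0) :
    f.signVariations + 1 ≤ ((X - 1) * f).signVariations := by
  simpa using succ_signVariations_le_X_sub_C_mul (η := (1 : ℝ)) one_pos hf

theorem le_signVariations_quotientComponent (P : ℕ → ℝ[X]) (r : ℕ)
    (hQ : ∀ j < r, quotientComponent P j ≠ 0) :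
    r ≤ (quotientComponent P r).signVariations +
      2 * ∑ j ∈ Finset.range r, (P (j + 1)).support.card := by
  induction r with
  | zero => simp
  | succ r ih =>
    have h1 := ih fun j hj => hQ j (by omega)
    have h2 := succ_signVariations_le_X_sub_one_mul (hQ r (by omega))
    have h3 := signVariations_le_sub_add_card_support
      ((X - 1) * quotientComponent P r) (P (r + 1))
    rw [Finset.sum_range_succ, quotientComponent]
    omega

/-- If the division terminates exactly at step `n + 2` and the component of degree `n + 1`
vanishes, then the components have many terms. -/
theorem le_two_mul_sum_card_support {P : ℕ → ℝ[X]} {n : ℕ}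
    (hQ : ∀ j < n + 2, quotientComponent P j ≠ 0) (hQn : quotientComponent P (n + 2) = 0)
    (hP : P (n + 1) = 0) :
    n + 6 ≤ 2 * ∑ j ∈ Finset.range (n + 3), (P j).support.card := by
  have h1 := le_signVariations_quotientComponent P (n + 1) fun j hj => hQ j (by omega)
  have e1 : quotientComponent P (n + 1) = (X - 1) * quotientComponent P n := by
    rw [quotientComponent, hP, sub_zero]
  have e2 : P (n + 2) = (X - 1) * quotientComponent P (n + 1) := by
    rw [quotientComponent] at hQn
    exact (sub_eq_zero.1 hQn).symm
  -- The vanishing component enters here: through `e1` it gives `Q_{n+1}` a sign variation, which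
  -- turns `n + 5` into `n + 6`.
  have h2 := succ_signVariations_le_X_sub_one_mul (hQ n (by omega))
  have h3 := succ_signVariations_le_X_sub_one_mul (hQ (n + 1) (by omega))
  rw [← e1] at h2
  rw [← e2] at h3
  have h0 : P (n + 2) ≠ 0 := by
    intro h
    simp [h] at h3
  have h4 := signVariations_add_one_le_card_support h0
  rw [Finset.sum_range_succ, Finset.sum_range_succ']
  omega

end Polynomial

/-! ### Homogeneous components of a bivariate polynomial -/

namespace MvPolynomial

open Finset

/-- The homogeneous component of degree `j` of `p(x, y)`, evaluated at `x = t`, `y = -1`. -/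
noncomputable def slice (p : MvPolynomial (Fin 2) ℝ) (j : ℕ) : Polynomial ℝ :=
  ∑ m ∈ p.support with m 0 + m 1 = j, Polynomial.monomial (m 0) (p.coeff m * (-1) ^ m 1)

theorem card_support_slice_le (p : MvPolynomial (Fin 2) ℝ) (j : ℕ) :
    (slice p j).support.card ≤ #{m ∈ p.support | m 0 + m 1 = j} := by
  classical
  have h : (slice p j).support ⊆ ({m ∈ p.support | m 0 + m 1 = j}).image (fun m => m 0) := by
    intro k hk
    rw [Polynomial.mem_support_iff, slice, Polynomial.finsetSum_coeff] at hk
    obtain ⟨m, hm, hmk⟩ := exists_ne_zero_of_sum_ne_zero hk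
    rw [Polynomial.coeff_monomial] at hmk
    exact mem_image.2 ⟨m, hm, by by_contra h; simp [h] at hmk⟩
  exact (card_le_card h).trans card_image_le

theorem apply_zero_add_apply_one_le_totalDegree {p : MvPolynomial (Fin 2) ℝ} {m : Fin 2 →₀ ℕ}
    (hm : m ∈ p.support) : m 0 + m 1 ≤ p.totalDegree := by
  have := le_totalDegree hm
  rwa [Finsupp.sum_fintype _ _ (fun _ => rfl), Fin.sum_univ_two] at this

theorem sum_card_support_slice_le (p : MvPolynomial (Fin 2) ℝ) :
    ∑ j ∈ range (p.totalDegree + 1), (slice p j).support.card ≤ #p.support := by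
  rw [card_eq_sum_card_fiberwise (f := fun m : Fin 2 →₀ ℕ => m 0 + m 1)
    (t := range (p.totalDegree + 1))]
  · exact sum_le_sum fun j _ => card_support_slice_le p j
  · intro m hm
    have := apply_zero_add_apply_one_le_totalDegree hm
    simp only [coe_range, Set.mem_Iio]
    omega

theorem eval_slice_div (p : MvPolynomial (Fin 2) ℝ) (j : ℕ) {t : ℝ} :
    (slice p j).eval t / (t - 1) ^ j =
      ∑ m ∈ p.support with m 0 + m 1 = j,
        p.coeff m * ((t / (t - 1)) ^ m 0 * (-1 / (t - 1)) ^ m 1) := by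
  rw [slice, Polynomial.eval_finsetSum, sum_div]
  refine sum_congr rfl fun m hm => ?_
  rw [← (mem_filter.1 hm).2, Polynomial.eval_monomial, div_pow, div_pow, pow_add]
  rw [div_mul_div_comm, ← mul_div_assoc]
  ring

theorem sum_eval_slice_div (p : MvPolynomial (Fin 2) ℝ) {t : ℝ} :
    ∑ j ∈ range (p.totalDegree + 1), (slice p j).eval t / (t - 1) ^ j =
      eval ![t / (t - 1), -1 / (t - 1)] p := by
  simp_rw [eval_slice_div]
  rw [sum_fiberwise_of_maps_to
    (fun m hm => mem_range.2 (Nat.lt_succ_of_le (apply_zero_add_apply_one_le_totalDegree hm))),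
    eval_eq']
  simp [Fin.prod_univ_two]

theorem quotientComponent_slice_totalDegree {p : MvPolynomial (Fin 2) ℝ}
    (hp : ∀ x y : ℝ, x + y = 1 → eval ![x, y] p = 1) :
    Polynomial.quotientComponent (slice p) p.totalDegree = 0 := by
  apply Polynomial.eq_zero_of_infinite_isRoot
  -- For `t ≠ 1` the point `(t / (t - 1), -1 / (t - 1))` lies on the line `x + y = 1`.
  refine (Set.finite_singleton (1 : ℝ)).infinite_compl.mono fun t ht => ?_
  have ht : t ≠ 1 := ht
  have hs : t - 1 ≠ 0 := sub_ne_zero.2 ht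
  rw [Set.mem_ofPred_eq, Polynomial.IsRoot, Polynomial.eval_quotientComponent _ _ ht,
    sum_eval_slice_div, hp _ _ (by field_simp; ring), sub_self, mul_zero]

theorem quotientComponent_slice_ne_zero {p : MvPolynomial (Fin 2) ℝ}
    (h0 : ∀ m, 0 ≤ p.coeff m) (hp : ∀ x y : ℝ, x + y = 1 → eval ![x, y] p = 1)
    {r : ℕ} (hr : r < p.totalDegree) : Polynomial.quotientComponent (slice p) r ≠ 0 := by
  intro h
  -- `t = -1` is the point `(1/2, 1/2)`, where every monomial is positive. If `Q_r = 0`, the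
  -- components up to degree `r` already sum to 1 there, leaving no room for the positive top
  -- component.
  have ht : (-1 : ℝ) ≠ 1 := by norm_num
  have h1 := Polynomial.eval_quotientComponent (slice p) r ht
  have h2 := Polynomial.eval_quotientComponent (slice p) p.totalDegree ht
  rw [h, Polynomial.eval_zero] at h1
  rw [quotientComponent_slice_totalDegree hp, Polynomial.eval_zero, sum_range_succ] at h2
  have h1' := (mul_eq_zero.1 h1.symm).resolve_left (pow_ne_zero _ (by norm_num))
  have h2' := (mul_eq_zero.1 h2.symm).resolve_left (pow_ne_zero _ (by norm_num))
  have hterm : ∀ m : Fin 2 →₀ ℕ, 0 < ((-1 : ℝ) / (-1 - 1)) ^ m 0 * (-1 / (-1 - 1)) ^ m 1 := by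
    intro m
    norm_num
  have hnn : ∀ j, 0 ≤ (slice p j).eval (-1) / (-1 - 1) ^ j := fun j => by
    rw [eval_slice_div]
    exact sum_nonneg fun m _ => mul_nonneg (h0 m) (hterm m).le
  have hne : p.support.Nonempty := by
    rw [nonempty_iff_ne_empty]
    intro h
    rw [support_eq_empty.1 h, totalDegree_zero] at hr
    omega
  obtain ⟨m, hm, hmd⟩ := exists_mem_eq_sup p.support hne fun s => s.sum fun _ e => e
  have hmd : m 0 + m 1 = p.totalDegree := by
    rw [totalDegree, hmd, Finsupp.sum_fintype _ _ (fun _ => rfl), Fin.sum_univ_two]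
  have hpos : 0 < (slice p p.totalDegree).eval (-1) / (-1 - 1) ^ p.totalDegree := by
    rw [eval_slice_div]
    exact sum_pos' (fun m _ => mul_nonneg (h0 m) (hterm m).le)
      ⟨m, mem_filter.2 ⟨hm, hmd⟩,
        mul_pos ((h0 m).lt_of_ne (mem_support_iff.1 hm).symm) (hterm m)⟩
  have hle := sum_le_sum_of_subset_of_nonneg (range_mono (Nat.succ_le_of_lt hr))
    fun j _ _ => hnn j
  simp only [Nat.succ_eq_add_one] at hle
  linarith

/-! ### A competitor with few terms -/

/-- The bivariate Lucas polynomials. -/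
noncomputable def lucas : ℕ → MvPolynomial (Fin 2) ℝ
  | 0 => 2
  | 1 => X 0
  | n + 2 => X 0 * lucas (n + 1) + X 1 * lucas n

theorem coeff_lucas_nonneg (n : ℕ) (m : Fin 2 →₀ ℕ) : 0 ≤ (lucas n).coeff m := by
  classical
  induction n using Nat.twoStepInduction generalizing m with
  | zero =>
    rw [lucas, ← map_ofNat C 2, coeff_C]
    split_ifs <;> norm_num
  | one =>
    rw [lucas, coeff_X]
    split_ifs <;> norm_num
  | more n ih1 ih2 =>
    rw [lucas, coeff_add, coeff_X_mul', coeff_X_mul']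
    refine add_nonneg ?_ ?_ <;> split_ifs <;> simp [ih1, ih2]

theorem isWeightedHomogeneous_lucas (n : ℕ) : IsWeightedHomogeneous ![1, 2] (lucas n) n := by
  induction n using Nat.twoStepInduction with
  | zero =>
    rw [lucas, ← map_ofNat C 2]
    exact isWeightedHomogeneous_C _ _
  | one => exact isWeightedHomogeneous_X ℝ ![1, 2] 0
  | more n ih1 ih2 =>
    rw [lucas]
    refine IsWeightedHomogeneous.add ?_ ?_
    · have := (isWeightedHomogeneous_X ℝ ![1, 2] (0 : Fin 2)).mul ih2
      convert this using 1
      simp; omega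
    · have := (isWeightedHomogeneous_X ℝ ![1, 2] (1 : Fin 2)).mul ih1
      convert this using 1
      simp; omega

theorem apply_add_two_mul_apply_of_mem_support_lucas {n : ℕ} {m : Fin 2 →₀ ℕ}
    (hm : m ∈ (lucas n).support) : m 0 + 2 * m 1 = n := by
  have := isWeightedHomogeneous_lucas n (mem_support_iff.1 hm)
  rw [Finsupp.weight_apply, Finsupp.sum_fintype _ _ (by simp), Fin.sum_univ_two] at this
  simp at this
  omega

/-- By weighted homogeneity the only possible monomials are `x ^ (n - 2k) y ^ k`. -/
theorem card_support_lucas_le (n : ℕ) : #(lucas n).support ≤ n / 2 + 1 := by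
  rw [← card_range (n / 2 + 1)]
  refine card_le_card_of_injOn (fun m => m 1) (fun m hm => ?_) fun m hm m' hm' h => ?_
  · have := apply_add_two_mul_apply_of_mem_support_lucas hm
    simp only [coe_range, Set.mem_Iio]
    omega
  · have h1 := apply_add_two_mul_apply_of_mem_support_lucas hm
    have h2 := apply_add_two_mul_apply_of_mem_support_lucas hm'
    ext i
    fin_cases i
    · simp at h ⊢; omega
    · exact h

/-- On the line, the characteristic equation `z ^ 2 = x z + y` has roots `1` and `-y`. -/
theorem eval_lucas (n : ℕ) {x y : ℝ} (h : x + y = 1) :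
    eval ![x, y] (lucas n) = 1 + (-y) ^ n := by
  obtain rfl : x = 1 - y := by linarith
  induction n using Nat.twoStepInduction with
  | zero => simp [lucas]; norm_num
  | one => simp [lucas]; ring
  | more n ih1 ih2 =>
    rw [lucas, map_add, map_mul, map_mul, ih1, ih2]
    simp
    ring

theorem lucas_add_pow_mem_H2 {d : ℕ} (hd : Odd d) : lucas d + X 1 ^ d ∈ H2 d := by
  classical
  have hnn : ∀ m, 0 ≤ (X 1 ^ d : MvPolynomial (Fin 2) ℝ).coeff m := fun m => by
    rw [coeff_X_pow]
    split_ifs <;> norm_num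
  refine ⟨le_antisymm ?_ ?_, fun m => ?_, fun x y h => ?_⟩
  · refine (totalDegree_add _ _).trans (max_le ?_ (by simp))
    refine Finset.sup_le fun m hm => ?_
    rw [Finsupp.sum_fintype _ _ (fun _ => rfl), Fin.sum_univ_two]
    have := apply_add_two_mul_apply_of_mem_support_lucas hm
    omega
  · have hmem : Finsupp.single 1 d ∈ (lucas d + X 1 ^ d).support := by
      rw [mem_support_iff, coeff_add]
      have := coeff_lucas_nonneg d (Finsupp.single 1 d)
      simp only [coeff_X_pow, if_true]
      linarith
    have := apply_zero_add_apply_one_le_totalDegree hmem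
    simpa using this
  · rw [coeff_add]
    exact add_nonneg (coeff_lucas_nonneg d m) (hnn m)
  · rw [map_add, eval_lucas d h, hd.neg_pow]
    simp

theorem numTerms_lucas_add_pow_le (d : ℕ) : numTerms (lucas d + X 1 ^ d) ≤ d / 2 + 2 := by
  classical
  have h1 := card_support_lucas_le d
  have h2 : #(X 1 ^ d : MvPolynomial (Fin 2) ℝ).support = 1 := by
    rw [support_X_pow, card_singleton]
  have h3 := card_le_card (support_add (p := lucas d) (q := X 1 ^ d))
  have h4 := card_union_le (lucas d).support (X 1 ^ d : MvPolynomial (Fin 2) ℝ).support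
  rw [numTerms]
  omega

end MvPolynomial

/-! ### Comparison of the two counts -/

open MvPolynomial in
theorem card_support_lower_bound {d : ℕ} (hd : 1 < d) {f : MvPolynomial (Fin 2) ℝ}
    (hf : f ∈ H2 d) (h : ∀ m : Fin 2 →₀ ℕ, m 0 + m 1 = d - 1 → f.coeff m = 0) :
    d + 4 ≤ 2 * numTerms f := by
  obtain ⟨rfl, h0, h1⟩ := hf
  obtain ⟨n, hn⟩ : ∃ n, f.totalDegree = n + 2 := ⟨f.totalDegree - 2, by omega⟩
  have key := Polynomial.le_two_mul_sum_card_support (P := slice f) (n := n)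
    (fun j hj => quotientComponent_slice_ne_zero h0 h1 (by omega))
    (by rw [← hn]; exact quotientComponent_slice_totalDegree h1)
    (by
      rw [slice]
      refine Finset.sum_eq_zero fun m hm => ?_
      rw [h m (by rw [(Finset.mem_filter.1 hm).2]; omega)]
      simp)
  have := sum_card_support_slice_le f
  rw [hn, show n + 2 + 1 = n + 3 from rfl] at this
  rw [numTerms, hn]
  omega

theorem lemma2 (d : ℕ) (hd : 1 < d) (hodd : Odd d) (f : MvPolynomial (Fin 2) ℝ)
    (hf : IsSharp d f) :
    ∃ m : Fin 2 →₀ ℕ, m 0 + m 1 = d - 1 ∧ f.coeff m ≠ 0 := by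
  by_contra! h
  have h1 := card_support_lower_bound hd hf.1 h
  have h2 := hf.2 _ (MvPolynomial.lucas_add_pow_mem_H2 hodd)
  have h3 := MvPolynomial.numTerms_lucas_add_pow_le d
  obtain ⟨k, rfl⟩ := hodd
  -- With `d = 2k + 1`, the bounds `2N ≥ 2k + 5` and `N ≤ k + 2` conflict.
  omega
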